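/- Let $k$ be an algebraically closed field of characteristic $0$. Let $\mathscr{Z}$ be the category whose objects are the $\mathbb{Z}$-sets $\mathbf{n}=\mathbb{Z}/n\mathbb{Z}$, $n\ge 1$, and whose morphisms are the $\mathbb{Z}$-equivariant maps (the orbit category of $(\mathbb{Z},+)$ with respect to its nontrivial subgroups). The endomorphisms of $\mathbf{n}$ form a cyclic group $G_n$ of order $n$, generated by translation by $1$. A $\mathscr{Z}^{\mathrm{op}}$-module is a functor $V$ from $\mathscr{Z}^{\mathrm{op}}$ to $k$-vector spaces, and we write $V_n$ for its value at $\mathbf{n}$. It is called torsion free if $V_f$ is injective for every morphism $f$ of $\mathscr{Z}^{\mathrm{op}}$, that is, if no nonzero element $v\in V_n$ satisfies $V_f(v)=0$ for some morphism $f$ of $\mathscr{Z}^{\mathrm{op}}$ starting at $\mathbf{n}$. For a primitive $n$-th root of unity $\xi\in k$, with $n\ge 1$, let $L_\xi$ be the one-dimensional $kG_n$-submodule of $kG_n=k\mathscr{Z}(\mathbf{n},\mathbf{n})$ on which the generator of $G_n$ acts as multiplication by $\xi$, and let $\underline{L}_\xi$ be the $\mathscr{Z}^{\mathrm{op}}$-submodule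 of $k\mathscr{Z}(-,\mathbf{n})$ generated by $L_\xi$ at the object $\mathbf{n}$. Theorem. The assignment $\xi\mapsto\underline{L}_\xi$ induces a bijection from the set of all primitive roots of unity in $k$ (primitive $n$-th roots of $1$ for all $n\ge1$) onto the set of isomorphism classes of $\mathscr{Z}^{\mathrm{op}}$-modules that are indecomposable, injective in the category of $\mathscr{Z}^{\mathrm{op}}$-modules, and torsion free. Moreover, if $\xi$ is a primitive $n$-th root of unity and $m\ge 1$, then $\underline{L}_\xi$ has the following value at $\mathbf{m}$. If $n\mid m$, the value is $L_\xi$, viewed as a $kG_m$-module: it is one-dimensional, translation by $1$ acts on it as multiplication by $\xi$, and the map $(\underline{L}_\xi)_n\to(\underline{L}_\xi)_m$ induced by the canonical map $\mathbf{m}\to\mathbf{n}$, $1\mapsto 1$, is bijective. If $n\nmid m$, the value is $0$. -/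

import Mathlib

open CategoryTheory Opposite

universe u

/-- Objects of the orbit category `𝒵` of `(ℤ, +)` with respect to the nontrivial subgroups `nℤ`,
`n ≥ 1`: the object with index `n` stands for the `ℤ`-set `ℤ/nℤ`. -/
structure OrbitZ where
  /-- the positive integer `n` of the orbit `ℤ/nℤ` -/
  idx : ℕ+

namespace OrbitZ

/-- A morphism `ℤ/mℤ → ℤ/nℤ` of `𝒵`: a map equivariant for the translation action of `ℤ`. -/
@[ext]
structure Hom (x y : OrbitZ) where
  /-- the underlying map of sets -/
  toFun : ZMod x.idx → ZMod y.idx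
  equivariant : ∀ (a : ℤ) (t : ZMod x.idx), toFun ((a : ZMod x.idx) + t) = (a : ZMod y.idx) + toFun t

instance : Category.{0} OrbitZ where
  Hom := Hom
  id x := ⟨fun t => t, fun _ _ => rfl⟩
  comp f g := ⟨fun t => g.toFun (f.toFun t), fun a t => by rw [f.equivariant, g.equivariant]⟩

/-- The generator of the cyclic group `G_n = 𝒵(n, n)`: translation by `1`. -/
def shift (x : OrbitZ) : x ⟶ x :=
  Hom.mk (fun t => 1 + t) (fun a t => by ring)

/-- The canonical morphism `ℤ/mℤ → ℤ/nℤ`, `1 ↦ 1`, for `n ∣ m`. -/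
def proj {x y : OrbitZ} (h : (y.idx : ℕ) ∣ (x.idx : ℕ)) : x ⟶ y :=
  Hom.mk (fun t => ZMod.castHom h (ZMod y.idx) t) (fun a t => by rw [map_add, map_intCast])

end OrbitZ

/-- `𝒵ᵒᵖ`-modules over `k`: covariant functors from `𝒵ᵒᵖ` to `k`-modules. -/
abbrev ZopModule (k : Type u) [Field k] := OrbitZᵒᵖ ⥤ ModuleCat.{u} k

namespace ZopModule

variable {k : Type u} [Field k]

/-- An element `v ∈ V_x` is torsion if some morphism starting at `x` kills it. -/
def IsTorsion (V : ZopModule k) {x : OrbitZᵒᵖ} (v : V.obj x) : Prop :=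
  ∃ (y : OrbitZᵒᵖ) (f : x ⟶ y), V.map f v = 0

/-- `V` is torsion free if its only torsion elements are the zero elements. -/
def TorsionFree (V : ZopModule k) : Prop :=
  ∀ (x : OrbitZᵒᵖ) (v : V.obj x), V.IsTorsion v → v = 0

/-- The submodule of `V` generated by a subspace `W` of the value `V_x`: its value at `y` is the
sum of the images of `W` under all morphisms `x ⟶ y`. -/
def generated (V : ZopModule k) (x : OrbitZᵒᵖ) (W : Submodule k (V.obj x)) : ZopModule k where
  obj y := ModuleCat.of k ↥(⨆ f : x ⟶ y, W.map (V.map f).hom)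
  map {y z} g := ModuleCat.ofHom ((V.map g).hom.restrict (by
    intro v hv
    have hle : (⨆ f : x ⟶ y, W.map (V.map f).hom) ≤
        (⨆ f : x ⟶ z, W.map (V.map f).hom).comap (V.map g).hom := by
      refine iSup_le fun f => ?_
      rintro _ ⟨w, hw, rfl⟩
      refine Submodule.mem_comap.2 (Submodule.mem_iSup_of_mem (f ≫ g) ⟨w, hw, ?_⟩)
      simp
    exact hle hv))
  map_id y := by
    refine ModuleCat.hom_ext (LinearMap.ext fun v => Subtype.ext ?_)
    simp
  map_comp f g := by
    refine ModuleCat.hom_ext (LinearMap.ext fun v => Subtype.ext ?_)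
    simp

end ZopModule

/-- The `𝒵ᵒᵖ`-module `k𝒵(-, n)`, the `k`-linearization of the presheaf represented by `n`. -/
noncomputable def linearization (k : Type u) [Field k] (x : OrbitZ) : ZopModule k where
  obj y := ModuleCat.of k ((y.unop ⟶ x) →₀ k)
  map g := ModuleCat.ofHom (Finsupp.lmapDomain k k (fun h => g.unop ≫ h))
  map_id y := by
    ext
    simp
  map_comp f g := by
    ext
    simp

/-- The `kG_n`-module `L_ξ`, realized in the regular module `kG_n = k𝒵(n, n)` as the subspace on
which the generator of `G_n` acts as multiplication by `ξ`. -/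
noncomputable def charSubmodule {k : Type u} [Field k] (n : ℕ+) (ξ : k) :
    Submodule k ((linearization k ⟨n⟩).obj (op ⟨n⟩)) :=
  Module.End.eigenspace ((linearization k ⟨n⟩).map (OrbitZ.shift ⟨n⟩).op).hom ξ

/-- The set of all primitive roots of unity in `k` (primitive `n`-th roots of `1`, for all `n ≥ 1`). -/
def PrimRoot (k : Type u) [Field k] : Type u :=
  {ξ : k // ∃ n : ℕ+, IsPrimitiveRoot ξ n}

/-- The unique `n ≥ 1` such that `ξ` is a primitive `n`-th root of `1`. -/
noncomputable def PrimRoot.order {k : Type u} [Field k] (ξ : PrimRoot k) : ℕ+ :=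
  ⟨orderOf ξ.1, by
    obtain ⟨n, hn⟩ := ξ.2
    rw [← hn.eq_orderOf]
    exact n.pos⟩

/-- The `𝒵ᵒᵖ`-module attached to a primitive `n`-th root of unity `ξ`: the submodule of `k𝒵(-, n)`
generated by `L_ξ ⊆ kG_n` at the object `n`. -/
noncomputable def rootModule {k : Type u} [Field k] (ξ : PrimRoot k) : ZopModule k :=
  (linearization k ⟨ξ.order⟩).generated (op ⟨ξ.order⟩) (charSubmodule ξ.order ξ.1)

/-- The set of isomorphism classes of `𝒵ᵒᵖ`-modules which are indecomposable, injective (as objects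
of the category of `𝒵ᵒᵖ`-modules) and torsion free. -/
def indecInjTorsionFreeClasses (k : Type u) [Field k] :
    Set (Quotient (isIsomorphicSetoid (ZopModule k))) :=
  {c | ∃ V : ZopModule k, Indecomposable V ∧ Injective V ∧ V.TorsionFree ∧
    c = Quotient.mk (isIsomorphicSetoid (ZopModule k)) V}

/-!
A `𝒵ᵒᵖ`-module `V` amounts to spaces `V_x` indexed by the positive integers, an operator `sigma V x`
on `V_x` with `x`-th power `1`, and equivariant transition maps `push` along divisibility: every
morphism of `𝒵` is a canonical projection followed by a translation (`ZopModule.map_eq`).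

For `ξ ^ m = 1` let `E(ξ, m)` (`ZopModule.eigenModel`) be the module which is the line `k` at the
multiples of `m` and `0` elsewhere, the generators acting as `ξ` and the transition maps between
lines being the identity. A morphism `E(ξ, m) ⟶ V` is a vector of `V_m` on which the generator acts
as `ξ` (`ZopModule.homOfEigenvector`). Applied to the spanning vector of `L_ξ`, this identifies the
module generated by `L_ξ` with `E(ξ, n)`, where `n` is the order of `ξ`
(`nonempty_eigenModel_iso_rootModule`). Its values, its torsion freeness, its indecomposability, and
the fact that it determines `ξ`, are then read off the model.

Injectivity of `E(ξ, n)` (`ZopModule.injective_eigenModel`): a morphism `A ⟶ E(ξ, n)` is a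
functional `φ` on the colimit of the values of `A` over the divisibility poset, with `φ ∘ σ = ξ φ`
for the induced operator `σ`. The poset is directed, so the colimit preserves monomorphisms; and `σ`
has finite orbits, hence acts semisimply in characteristic `0`, so such functionals extend
(`exists_extend_eigenfunctional`).

Conversely, let `V` be indecomposable, injective and torsion free. Some `V_m` is nonzero and
contains an eigenvector, with eigenvalue `ξ` of order `n ∣ m`; it defines a morphism
`E(ξ, m) ⟶ V`. Since `E(ξ, m)` is a submodule of `E(ξ, n)` and `V` is injective, the morphism
extends to `E(ξ, n)`, and the extension is a monomorphism because `V` is torsion free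
(`ZopModule.exists_mono_of_eigenvector`). As `E(ξ, n)` is injective, it is a direct summand of `V`,
hence all of `V`.
-/

/-! ### Morphisms of the orbit category and the structure maps of a module -/

namespace OrbitZ

/-- A morphism of `𝒵` is determined by its value at `0`. -/
theorem hom_ext_zero {x y : OrbitZ} {f g : x ⟶ y} (h : Hom.toFun f 0 = Hom.toFun g 0) : f = g := by
  apply Hom.ext
  funext t
  have hf := Hom.equivariant f ((t.val : ℕ) : ℤ) 0
  have hg := Hom.equivariant g ((t.val : ℕ) : ℤ) 0
  simp only [Int.cast_natCast, ZMod.natCast_zmod_val, add_zero] at hf hg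
  rw [hf, hg, h]

theorem dvd_of_hom {x y : OrbitZ} (f : x ⟶ y) : (y.idx : ℕ) ∣ x.idx := by
  have h := Hom.equivariant f ((x.idx : ℕ) : ℤ) 0
  simp only [Int.cast_natCast, CharP.cast_eq_zero, zero_add] at h
  exact (ZMod.natCast_eq_zero_iff _ _).1 (right_eq_add.1 h)

theorem toFun_id {x : OrbitZ} (t : ZMod x.idx) : Hom.toFun (𝟙 x) t = t := rfl

theorem toFun_comp {x y z : OrbitZ} (f : x ⟶ y) (g : y ⟶ z) (t : ZMod x.idx) :
    Hom.toFun (f ≫ g) t = Hom.toFun g (Hom.toFun f t) := rfl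

/-- Translation by a natural number, as an endomorphism in `𝒵`. -/
def translateBy (x : OrbitZ) (j : ℕ) : x ⟶ x :=
  Hom.mk (fun t => (j : ZMod x.idx) + t) (fun a t => by ring)

/-- The amount `f 0`, as a natural number below `y.idx`, by which a morphism `f` to `y` differs from
the canonical one. -/
def offset {x y : OrbitZ} (f : x ⟶ y) : ℕ := (Hom.toFun f 0).val

theorem offset_cast {x y : OrbitZ} (f : x ⟶ y) :
    ((offset f : ℕ) : ZMod y.idx) = Hom.toFun f 0 := by
  simp [offset]

theorem offset_comp {x y z : OrbitZ} (f : x ⟶ y) (g : y ⟶ z) :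
    ((offset (f ≫ g) : ℕ) : ZMod z.idx) = (offset f + offset g : ℕ) := by
  have h := Hom.equivariant g ((offset f : ℕ) : ℤ) 0
  simp only [Int.cast_natCast, add_zero, offset_cast] at h
  rw [offset_cast, toFun_comp, h, Nat.cast_add, offset_cast g]

theorem offset_id (x : OrbitZ) : offset (𝟙 x) = 0 := by simp [offset, toFun_id]

theorem offset_proj {x y : OrbitZ} (h : (y.idx : ℕ) ∣ x.idx) : offset (proj h) = 0 := by
  simp [offset, proj]

theorem offset_shift (x : OrbitZ) : ((offset (shift x) : ℕ) : ZMod x.idx) = (1 : ℕ) := by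
  rw [offset_cast]
  simp [shift]

theorem translateBy_zero (x : OrbitZ) : translateBy x 0 = 𝟙 x :=
  hom_ext_zero (by rw [toFun_id]; simp [translateBy])

theorem shift_translateBy (x : OrbitZ) (j : ℕ) :
    shift x ≫ translateBy x j = translateBy x (j + 1) :=
  hom_ext_zero (by rw [toFun_comp]; simp [translateBy, shift])

theorem translateBy_idx (x : OrbitZ) : translateBy x x.idx = 𝟙 x :=
  hom_ext_zero (by rw [toFun_id]; simp [translateBy])

theorem eq_translateBy_offset {x : OrbitZ} (f : x ⟶ x) : f = translateBy x (offset f) :=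
  hom_ext_zero (by simp [translateBy, offset_cast])

/-- Every morphism of `𝒵` is a canonical one followed by a translation. -/
theorem eq_proj_translateBy {x y : OrbitZ} (f : x ⟶ y) :
    f = proj (dvd_of_hom f) ≫ translateBy y (offset f) := by
  apply hom_ext_zero
  rw [toFun_comp]
  simp [proj, translateBy, offset_cast]

theorem proj_comp {x y z : OrbitZ} (h : (y.idx : ℕ) ∣ x.idx) (h' : (z.idx : ℕ) ∣ y.idx) :
    proj h ≫ proj h' = proj (h'.trans h) := by
  apply hom_ext_zero
  rw [toFun_comp]
  simp [proj]

theorem proj_self {x : OrbitZ} (h : (x.idx : ℕ) ∣ x.idx) : proj h = 𝟙 x := by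
  apply hom_ext_zero
  rw [toFun_id]
  simp [proj]

theorem shift_proj {x y : OrbitZ} (h : (y.idx : ℕ) ∣ x.idx) :
    shift x ≫ proj h = proj h ≫ shift y := by
  apply hom_ext_zero
  rw [toFun_comp, toFun_comp]
  simp [proj, shift, ZMod.cast_one h]

theorem proj_surjective {x y : OrbitZ} (h : (y.idx : ℕ) ∣ x.idx) :
    Function.Surjective (Hom.toFun (proj h)) :=
  ZMod.castHom_surjective h

end OrbitZ

namespace ZopModule
open OrbitZ
variable {k : Type u} [Field k]

/-- The action of the generator of `G_x` on the value of `V` at `x`. -/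
noncomputable def sigma (V : ZopModule k) (x : OrbitZ) : Module.End k (V.obj (op x)) :=
  (V.map (shift x).op).hom

/-- The map induced by the canonical morphism `x ⟶ y`. -/
noncomputable def push (V : ZopModule k) {x y : OrbitZ} (h : (y.idx : ℕ) ∣ x.idx) :
    V.obj (op y) →ₗ[k] V.obj (op x) :=
  (V.map (proj h).op).hom

theorem map_translateBy (V : ZopModule k) (x : OrbitZ) (j : ℕ) (v : V.obj (op x)) :
    V.map (translateBy x j).op v = (sigma V x ^ j) v := by
  induction j with
  | zero =>
    rw [translateBy_zero]
    simp
  | succ j ih =>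
    rw [← shift_translateBy, pow_succ', Module.End.mul_apply, ← ih, op_comp, V.map_comp]
    rfl

/-- A `𝒵ᵒᵖ`-module is determined by its values, the generators `sigma` and the maps `push`. -/
theorem map_eq (V : ZopModule k) {x y : OrbitZ} (f : x ⟶ y) (v : V.obj (op y)) :
    V.map f.op v = push V (dvd_of_hom f) ((sigma V y ^ offset f) v) := by
  conv_lhs => rw [eq_proj_translateBy f, op_comp, V.map_comp]
  rw [← map_translateBy]
  rfl

theorem sigma_pow_idx (V : ZopModule k) (x : OrbitZ) : sigma V x ^ (x.idx : ℕ) = 1 := by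
  ext v
  rw [← map_translateBy, translateBy_idx]
  simp

theorem push_sigma (V : ZopModule k) {x y : OrbitZ} (h : (y.idx : ℕ) ∣ x.idx) (v : V.obj (op y)) :
    push V h (sigma V y v) = sigma V x (push V h v) := by
  have := congrArg (fun f => V.map f.op v) (shift_proj h)
  simp only [op_comp, V.map_comp] at this
  exact this.symm

theorem push_push (V : ZopModule k) {x y z : OrbitZ} (h : (y.idx : ℕ) ∣ x.idx)
    (h' : (z.idx : ℕ) ∣ y.idx) (v : V.obj (op z)) :
    push V h (push V h' v) = push V (h'.trans h) v := by
  have := congrArg (fun f => V.map f.op v) (proj_comp h h')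
  simp only [op_comp, V.map_comp] at this
  exact this

theorem push_self (V : ZopModule k) {x : OrbitZ} (h : (x.idx : ℕ) ∣ x.idx) (v : V.obj (op x)) :
    push V h v = v := by
  unfold push
  rw [proj_self]
  simp

theorem naturality_apply {V W : ZopModule k} (α : V ⟶ W) {x y : OrbitZᵒᵖ} (f : x ⟶ y)
    (v : V.obj x) : α.app y (V.map f v) = W.map f (α.app x v) :=
  congrArg (fun g => g.hom v) (α.naturality f)

theorem app_push {V W : ZopModule k} (α : V ⟶ W) {x y : OrbitZ} (h : (y.idx : ℕ) ∣ x.idx)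
    (v : V.obj (op y)) : α.app (op x) (push V h v) = push W h (α.app (op y) v) :=
  naturality_apply α _ v

theorem app_sigma {V W : ZopModule k} (α : V ⟶ W) (x : OrbitZ)
    (v : V.obj (op x)) : α.app (op x) (sigma V x v) = sigma W x (α.app (op x) v) :=
  naturality_apply α _ v

theorem sigma_pow_of_eigen (V : ZopModule k) {x : OrbitZ} {ξ : k} {v : V.obj (op x)}
    (hv : sigma V x v = ξ • v) (j : ℕ) : (sigma V x ^ j) v = ξ ^ j • v := by
  induction j with
  | zero => simp
  | succ j ih => rw [pow_succ, Module.End.mul_apply, hv, map_smul, ih, smul_smul, pow_succ, mul_comm]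

theorem pow_idx_eq_one (V : ZopModule k) {x : OrbitZ} {ξ : k} {v : V.obj (op x)}
    (hv : sigma V x v = ξ • v) (h0 : v ≠ 0) : ξ ^ (x.idx : ℕ) = 1 := by
  have h := sigma_pow_of_eigen V hv x.idx
  rw [sigma_pow_idx, Module.End.one_apply] at h
  have h2 : (ξ ^ (x.idx : ℕ) - 1) • v = 0 := by rw [sub_smul, ← h, one_smul, sub_self]
  exact sub_eq_zero.1 ((smul_eq_zero.1 h2).resolve_right h0)

theorem mono_iff {V W : ZopModule k} (α : V ⟶ W) :
    Mono α ↔ ∀ x : OrbitZ, Function.Injective (α.app (op x)) := by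
  rw [NatTrans.mono_iff_mono_app]
  simp only [ModuleCat.mono_iff_injective]
  exact ⟨fun h x => h (op x), fun h x => h x.unop⟩

end ZopModule

/-! ### Eigenvectors and eigenfunctionals of operators of finite order -/

open Polynomial in
theorem exists_eigenvector_of_aeval_prod {k M : Type*} [Field k] [AddCommGroup M] [Module k M]
    (σ : Module.End k M) (s : Multiset k) (v : M) (hv : v ≠ 0)
    (h : aeval σ (s.map fun a => X - C a).prod v = 0) :
    ∃ (a : k) (w : M), w ≠ 0 ∧ σ w = a • w := by
  induction s using Multiset.induction_on generalizing v with
  | empty => simp [hv] at h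
  | cons a s ih =>
    by_cases h0 : σ v - a • v = 0
    · exact ⟨a, v, hv, sub_eq_zero.1 h0⟩
    · refine ih _ h0 ?_
      rw [Multiset.map_cons, Multiset.prod_cons, mul_comm, map_mul, Module.End.mul_apply] at h
      simpa [Module.algebraMap_end_apply] using h

open Polynomial in
/-- An endomorphism of finite order of a nonzero space over an algebraically closed field has an
eigenvector, with no finiteness assumption on the space. -/
theorem exists_eigenvector_of_pow_eq_one {k M : Type*} [Field k] [IsAlgClosed k] [AddCommGroup M]
    [Module k M] (σ : Module.End k M) {n : ℕ} (hn : 0 < n) (hσ : σ ^ n = 1) (v : M) (hv : v ≠ 0) :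
    ∃ (a : k) (w : M), w ≠ 0 ∧ σ w = a • w := by
  refine exists_eigenvector_of_aeval_prod σ (X ^ n - 1 : k[X]).roots v hv ?_
  have hm : (X ^ n - 1 : k[X]).Monic := by simpa using monic_X_pow_sub_C (1 : k) hn.ne'
  rw [← (IsAlgClosed.splits (X ^ n - 1 : k[X])).eq_prod_roots_of_monic hm]
  simp [hσ]

open Polynomial in
/-- For an equivariant embedding `ι`, an element of `M` in the range of `T - ξ` is in the range of
`S - ξ`. There is a polynomial `q` coprime to `X - ξ` such that `q * (X - ξ)` kills `b`: since
`X ^ n - 1` is separable, it is `(X ^ n - 1) / (X - ξ)` or `X ^ n - 1`, according to whether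
`ξ ^ n = 1`. Then `q` kills `a`, so that `X - ξ` is invertible on the cyclic module of `a`. -/
theorem mem_range_of_mem_range {k M N : Type*} [Field k] [CharZero k] [AddCommGroup M] [Module k M]
    [AddCommGroup N] [Module k N] (S : Module.End k M) (T : Module.End k N) (ι : M →ₗ[k] N)
    (hι : Function.Injective ι) (hST : ∀ a, ι (S a) = T (ι a)) (ξ : k) (a : M) (b : N) {n : ℕ}
    (hn : 0 < n) (hb : (T ^ n) b = b) (hab : ι a = T b - ξ • b) : ∃ c, a = S c - ξ • c := by
  obtain ⟨q, ⟨r, hr⟩, hq⟩ : ∃ q : k[X], (X ^ n - 1 ∣ q * (X - C ξ)) ∧ IsCoprime q (X - C ξ) := by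
    have hsep : (X ^ n - 1 : k[X]).Separable := by
      have := separable_X_pow_sub_C (1 : k) (n := n) (by exact_mod_cast hn.ne') one_ne_zero
      simpa using this
    by_cases hroot : (X ^ n - 1 : k[X]).IsRoot ξ
    · obtain ⟨q, hq⟩ := dvd_iff_isRoot.2 hroot
      rw [hq] at hsep
      exact ⟨q, ⟨1, by rw [hq]; ring⟩, hsep.isCoprime.symm⟩
    · refine ⟨X ^ n - 1, Dvd.intro _ rfl, IsCoprime.symm ?_⟩
      exact (irreducible_X_sub_C ξ).coprime_iff_not_dvd.2 fun h => hroot (dvd_iff_isRoot.1 h)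
  have hcomm : ∀ (p : k[X]) (c : M), ι (aeval S p c) = aeval T p (ι c) := by
    intro p c
    induction p using Polynomial.induction_on' with
    | add p q hp hq => simp [hp, hq]
    | monomial j t =>
      have : ∀ j (c : M), ι ((S ^ j) c) = (T ^ j) (ι c) := by
        intro j
        induction j with
        | zero => simp
        | succ j ih => intro c; rw [pow_succ, pow_succ, Module.End.mul_apply, ih, hST]; rfl
      simp [aeval_monomial, Module.algebraMap_end_apply, this]
  have hqa : aeval S q a = 0 := by
    apply hι
    have h1 : T b - ξ • b = aeval T (X - C ξ) b := by
      simp [Module.algebraMap_end_apply]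
    rw [hcomm, hab, h1, map_zero, ← Module.End.mul_apply, ← map_mul, hr, mul_comm, map_mul,
      Module.End.mul_apply]
    simp [hb]
  obtain ⟨u, w, huw⟩ := hq
  refine ⟨aeval S w a, ?_⟩
  have h2 : aeval S (u * q + w * (X - C ξ)) a = a := by rw [huw]; simp
  rw [map_add, LinearMap.add_apply, map_mul, Module.End.mul_apply, hqa, map_zero, zero_add,
    mul_comm, map_mul, Module.End.mul_apply] at h2
  simpa [Module.algebraMap_end_apply] using h2.symm

/-- Extension of a functional `φ` with `φ ∘ S = ξ φ` along an equivariant embedding, for an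
endomorphism `T` all of whose orbits are finite. Such functionals on `N` are the functionals on the
quotient by the range of `T - ξ`, and `φ` vanishes on the kernel of the map from `M` to it. -/
theorem exists_extend_eigenfunctional {k M N : Type*} [Field k] [CharZero k] [AddCommGroup M]
    [Module k M] [AddCommGroup N] [Module k N] (S : Module.End k M) (T : Module.End k N)
    (ι : M →ₗ[k] N) (hι : Function.Injective ι) (hST : ∀ a, ι (S a) = T (ι a)) (ξ : k)
    (hT : ∀ b, ∃ n : ℕ, 0 < n ∧ (T ^ n) b = b) (φ : M →ₗ[k] k) (hφ : ∀ a, φ (S a) = ξ * φ a) :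
    ∃ ψ : N →ₗ[k] k, (∀ b, ψ (T b) = ξ * ψ b) ∧ ∀ a, ψ (ι a) = φ a := by
  set D : Module.End k N := T - ξ • (1 : Module.End k N) with hD
  set j : M →ₗ[k] N ⧸ LinearMap.range D := (LinearMap.range D).mkQ ∘ₗ ι with hj
  have hker : φ ∈ (LinearMap.ker j).dualAnnihilator := by
    rw [Submodule.mem_dualAnnihilator]
    intro a ha
    obtain ⟨b, hb⟩ := (Submodule.Quotient.mk_eq_zero _).1 (LinearMap.mem_ker.1 ha)
    obtain ⟨n, hn, hbn⟩ := hT b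
    obtain ⟨c, rfl⟩ := mem_range_of_mem_range S T ι hι hST ξ a b hn hbn (by rw [← hb]; simp [hD])
    rw [map_sub, hφ, map_smul, smul_eq_mul, sub_self]
  rw [← LinearMap.range_dualMap_eq_dualAnnihilator_ker] at hker
  obtain ⟨χ, hχ⟩ := hker
  refine ⟨χ ∘ₗ (LinearMap.range D).mkQ, fun b => ?_, fun a => congrArg (fun f => f a) hχ⟩
  have h0 : (LinearMap.range D).mkQ (T b - ξ • b) = 0 :=
    (Submodule.Quotient.mk_eq_zero _).2 ⟨b, by simp [hD]⟩
  have := congrArg χ h0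
  rw [map_zero, map_sub, map_sub, sub_eq_zero, map_smul, map_smul] at this
  exact this

/-! ### The modules `E(ξ, m)` -/

namespace ZopModule
open OrbitZ
variable {k : Type u} [Field k]

/-- The value at `y` of the model `eigenModel`: all of `k` if `m ∣ y`, and `0` otherwise. -/
def eigenFiber (k : Type u) [Field k] (m : ℕ+) (y : OrbitZ) : Submodule k k where
  carrier := {c | ¬ (m : ℕ) ∣ y.idx → c = 0}
  add_mem' ha hb h := by rw [ha h, hb h, add_zero]
  zero_mem' _ := rfl
  smul_mem' r c hc h := by rw [hc h, smul_zero]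

theorem pow_eq_of_cast_eq {ξ : k} {m : ℕ} {y : OrbitZ} (hξ : ξ ^ m = 1) (h : m ∣ y.idx) {i j : ℕ}
    (hij : (i : ZMod y.idx) = j) : ξ ^ i = ξ ^ j := by
  have h1 : ξ ^ (y.idx : ℕ) = 1 := by
    obtain ⟨c, hc⟩ := h
    rw [hc, pow_mul, hξ, one_pow]
  rw [← pow_mod_orderOf ξ i, ← pow_mod_orderOf ξ j]
  congr 1
  exact ((ZMod.natCast_eq_natCast_iff _ _ _).1 hij).of_dvd (orderOf_dvd_of_pow_eq_one h1)

theorem eigenFiber_pow_mul {ξ : k} {m : ℕ+} (hξ : ξ ^ (m : ℕ) = 1) {y : OrbitZ} {i j : ℕ} {c : k}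
    (hc : c ∈ eigenFiber k m y) (hij : (i : ZMod y.idx) = j) : ξ ^ i * c = ξ ^ j * c := by
  by_cases h : (m : ℕ) ∣ y.idx
  · rw [pow_eq_of_cast_eq hξ h hij]
  · rw [hc h, mul_zero, mul_zero]

/-- For `ξ ^ m = 1`, the `𝒵ᵒᵖ`-module with value `k` at the multiples of `m` and `0` elsewhere, on
which a morphism `f` acts as multiplication by `ξ ^ f(0)`. For `ξ` of order `n` it is a model of
`L_ξ` if `m = n`, and a submodule of this model if `n ∣ m`. -/
def eigenModel (ξ : k) (m : ℕ+) (hξ : ξ ^ (m : ℕ) = 1) : ZopModule k where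
  obj y := ModuleCat.of k (eigenFiber k m y.unop)
  map {y z} f := ModuleCat.ofHom
    ((ξ ^ offset f.unop • (LinearMap.id : k →ₗ[k] k)).restrict (p := eigenFiber k m y.unop)
      (q := eigenFiber k m z.unop) (by
        intro c hc h
        have : c = 0 := hc fun h' => h (h'.trans (dvd_of_hom f.unop))
        simp [this]))
  map_id y := by
    refine ModuleCat.hom_ext (LinearMap.ext fun v => Subtype.ext ?_)
    simp [offset_id]
  map_comp {x y z} f g := by
    refine ModuleCat.hom_ext (LinearMap.ext fun v => Subtype.ext ?_)
    have := eigenFiber_pow_mul hξ v.2 (offset_comp g.unop f.unop)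
    rw [pow_add, mul_assoc] at this
    exact this

section
variable {ξ : k} {m : ℕ+} {hξ : ξ ^ (m : ℕ) = 1}

/-- An element of a value of `eigenModel`, as a scalar. It carries the equations between elements of
`eigenModel` over to `k`. -/
def eigenVal {y : OrbitZᵒᵖ} : (eigenModel ξ m hξ).obj y →ₗ[k] k := (eigenFiber k m y.unop).subtype

theorem eigenVal_injective {y : OrbitZᵒᵖ} :
    Function.Injective (eigenVal : (eigenModel ξ m hξ).obj y → k) := Subtype.val_injective

theorem eigenVal_eq_zero {y : OrbitZᵒᵖ} (h : ¬ (m : ℕ) ∣ y.unop.idx)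
    (c : (eigenModel ξ m hξ).obj y) : eigenVal c = 0 := c.2 h

/-- The element of a value of `eigenModel` given by a scalar. -/
def eigenElt (ξ : k) (m : ℕ+) (hξ : ξ ^ (m : ℕ) = 1) {y : OrbitZᵒᵖ} (h : (m : ℕ) ∣ y.unop.idx)
    (c : k) : (eigenModel ξ m hξ).obj y := (⟨c, fun h' => absurd h h'⟩ : eigenFiber k m y.unop)

theorem eigenVal_eigenElt {y : OrbitZᵒᵖ} (h : (m : ℕ) ∣ y.unop.idx) (c : k) :
    eigenVal (eigenElt ξ m hξ h c) = c := rfl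

theorem eigenVal_map {y z : OrbitZᵒᵖ} (f : y ⟶ z) (c : (eigenModel ξ m hξ).obj y) :
    eigenVal ((eigenModel ξ m hξ).map f c) = ξ ^ offset f.unop * eigenVal c := rfl

theorem eigenVal_push {x y : OrbitZ} (h : (y.idx : ℕ) ∣ x.idx)
    (c : (eigenModel ξ m hξ).obj (op y)) :
    eigenVal (push (eigenModel ξ m hξ) h c) = eigenVal c := by
  have := eigenVal_map (proj h).op c
  rwa [Quiver.Hom.unop_op, offset_proj, pow_zero, one_mul] at this

theorem sigma_eigenModel {x : OrbitZ} (c : (eigenModel ξ m hξ).obj (op x)) :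
    sigma (eigenModel ξ m hξ) x c = ξ • c := by
  apply eigenVal_injective
  have := eigenVal_map (shift x).op c
  refine this.trans ?_
  have h2 := eigenFiber_pow_mul hξ c.2 (offset_shift x)
  rw [pow_one] at h2
  rw [map_smul]
  exact h2

/-- A family of functionals compatible with the maps `push` and the generators of the groups `G_y`
is a morphism to `eigenModel`. -/
def homToEigen (A : ZopModule k) (φ : ∀ y : OrbitZ, A.obj (op y) →ₗ[k] k)
    (h0 : ∀ y a, ¬ (m : ℕ) ∣ y.idx → φ y a = 0)
    (hp : ∀ (x y : OrbitZ) (h : (y.idx : ℕ) ∣ x.idx) a, φ x (push A h a) = φ y a)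
    (hs : ∀ y a, φ y (sigma A y a) = ξ * φ y a) : A ⟶ eigenModel ξ m hξ where
  app y := ModuleCat.ofHom ((φ y.unop).codRestrict (eigenFiber k m y.unop) (fun a => h0 _ a))
  naturality {y z} f := by
    refine ModuleCat.hom_ext (LinearMap.ext fun v => eigenVal_injective ?_)
    have h1 : ∀ (j : ℕ) (a : A.obj y), φ y.unop ((sigma A y.unop ^ j) a) = ξ ^ j * φ y.unop a := by
      intro j a
      induction j with
      | zero => simp
      | succ j ih =>
        rw [pow_succ', Module.End.mul_apply, hs, ih]
        ring
    have h2 : φ z.unop (A.map f v) = ξ ^ offset f.unop * φ y.unop v := by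
      have := map_eq A f.unop v
      rw [Quiver.Hom.op_unop] at this
      rw [this, hp, h1]
    exact h2

/-- The component at `y` of `homOfEigenvector`. -/
noncomputable def eigenComponent (ξ : k) (m : ℕ+) (hξ : ξ ^ (m : ℕ) = 1) {V : ZopModule k}
    (v : V.obj (op ⟨m⟩)) (y : OrbitZ) : (eigenModel ξ m hξ).obj (op y) →ₗ[k] V.obj (op y) :=
  if h : (m : ℕ) ∣ y.idx then
    (eigenVal (ξ := ξ) (m := m) (hξ := hξ) (y := op y)).smulRight (push V (x := y) (y := ⟨m⟩) h v)
  else 0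

theorem eigenComponent_apply {V : ZopModule k} (v : V.obj (op ⟨m⟩)) {y : OrbitZ}
    (h : (m : ℕ) ∣ y.idx) (c : (eigenModel ξ m hξ).obj (op y)) :
    eigenComponent ξ m hξ v y c = eigenVal c • push V (x := y) (y := ⟨m⟩) h v := by
  simp only [eigenComponent, h, ↓reduceDIte, LinearMap.smulRight_apply]

/-- A vector `v` at `m` on which the generator acts as `ξ` defines a morphism from `eigenModel`,
sending `1` to `v`. -/
noncomputable def homOfEigenvector {V : ZopModule k} (v : V.obj (op ⟨m⟩))
    (hv : sigma V ⟨m⟩ v = ξ • v) : eigenModel ξ m hξ ⟶ V where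
  app y := ModuleCat.ofHom (eigenComponent ξ m hξ v y.unop)
  naturality {y z} f := by
    refine ModuleCat.hom_ext (LinearMap.ext fun c => ?_)
    by_cases hy : (m : ℕ) ∣ y.unop.idx
    · have hz : (m : ℕ) ∣ z.unop.idx := hy.trans (dvd_of_hom f.unop)
      have h1 := map_eq V f.unop (push V (y := ⟨m⟩) hy v)
      have h2 : sigma V y.unop (push V (y := ⟨m⟩) hy v) = ξ • push V (y := ⟨m⟩) hy v := by
        rw [← push_sigma, hv, map_smul]
      rw [Quiver.Hom.op_unop, sigma_pow_of_eigen V h2, map_smul, push_push] at h1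
      have h3 : eigenComponent ξ m hξ v z.unop ((eigenModel ξ m hξ).map f c) =
          V.map f (eigenComponent ξ m hξ v y.unop c) := by
        refine (eigenComponent_apply v hz _).trans ?_
        refine Eq.trans ?_ (congrArg (V.map f) (eigenComponent_apply v hy c)).symm
        refine Eq.trans ?_ (map_smul (V.map f).hom _ _).symm
        refine Eq.trans ?_ (congrArg (eigenVal c • ·) h1).symm
        rw [eigenVal_map, mul_comm, mul_smul]
      exact h3
    · have : c = 0 := eigenVal_injective (by rw [eigenVal_eq_zero hy, map_zero])
      rw [this, map_zero, map_zero]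

theorem homOfEigenvector_app {V : ZopModule k} (v : V.obj (op ⟨m⟩)) (hv : sigma V ⟨m⟩ v = ξ • v)
    {y : OrbitZ} (h : (m : ℕ) ∣ y.idx) (c : (eigenModel ξ m hξ).obj (op y)) :
    (homOfEigenvector v hv).app (op y) c = eigenVal c • push V (x := y) (y := ⟨m⟩) h v :=
  eigenComponent_apply v h c

end

theorem eq_of_eigenModel_iso {ξ η : k} {n m : ℕ+} {hξ : ξ ^ (n : ℕ) = 1} {hη : η ^ (m : ℕ) = 1}
    (e : eigenModel ξ n hξ ≅ eigenModel η m hη) : ξ = η := by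
  let c : (eigenModel ξ n hξ).obj (op ⟨n⟩) := eigenElt ξ n hξ (y := op ⟨n⟩) dvd_rfl 1
  have hc : e.hom.app (op ⟨n⟩) c ≠ 0 := by
    intro h
    have h1 : e.inv.app (op ⟨n⟩) (e.hom.app (op ⟨n⟩) c) = c :=
      congrArg (fun α => (α.app (op ⟨n⟩)).hom c) e.hom_inv_id
    rw [h, map_zero] at h1
    have h2 := congrArg eigenVal h1
    rw [map_zero, eigenVal_eigenElt] at h2
    exact zero_ne_one h2
  have h := app_sigma e.hom ⟨n⟩ c
  rw [sigma_eigenModel, sigma_eigenModel, map_smul, ← sub_eq_zero, ← sub_smul] at h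
  exact sub_eq_zero.1 ((smul_eq_zero.1 h).resolve_right hc)

theorem finrank_eigenModel {ξ : k} {n : ℕ+} (hξ : ξ ^ (n : ℕ) = 1) {x : OrbitZ}
    (h : (n : ℕ) ∣ x.idx) : Module.finrank k ((eigenModel ξ n hξ).obj (op x)) = 1 := by
  rw [← Module.finrank_self k]
  exact (LinearEquiv.ofBijective eigenVal
    ⟨eigenVal_injective, fun c => ⟨eigenElt ξ n hξ (y := op x) h c, rfl⟩⟩).finrank_eq

theorem torsionFree_eigenModel {ξ : k} {m : ℕ+} (hξ : ξ ^ (m : ℕ) = 1) :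
    (eigenModel ξ m hξ).TorsionFree := by
  rintro x v ⟨y, f, hf⟩
  have h := congrArg eigenVal hf
  have hξ0 : ξ ≠ 0 := by
    rintro rfl
    simp at hξ
  rw [eigenVal_map, map_zero] at h
  refine eigenVal_injective ?_
  rw [map_zero]
  exact (mul_eq_zero.1 h).resolve_left (pow_ne_zero _ hξ0)

/-- A direct summand of `eigenModel ξ m` which vanishes at `m` is zero, as `eigenModel ξ m` is
generated by its value at `m`; that value is a line, so one of two complementary summands vanishes
there. -/
theorem indecomposable_eigenModel {ξ : k} {m : ℕ+} (hξ : ξ ^ (m : ℕ) = 1) :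
    Indecomposable (eigenModel ξ m hξ) := by
  have key : ∀ (Y : ZopModule k) (i : Y ⟶ eigenModel ξ m hξ) (r : eigenModel ξ m hξ ⟶ Y),
      i ≫ r = 𝟙 Y → (∀ y : Y.obj (op ⟨m⟩), y = 0) → Limits.IsZero Y := by
    intro Y i r hir h0
    rw [Functor.isZero_iff]
    intro x
    rw [ModuleCat.isZero_iff_subsingleton]
    refine subsingleton_of_forall_eq 0 fun y => ?_
    have hy : r.app x (i.app x y) = y := congrArg (fun α => (α.app x).hom y) hir
    by_cases hx : (m : ℕ) ∣ x.unop.idx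
    · -- `i y` comes from the value at `m`, so `y = r (i y)` comes from `Y_m = 0`
      have h1 : i.app x y = push (eigenModel ξ m hξ) (x := x.unop) (y := ⟨m⟩) hx
          (eigenElt ξ m hξ (y := op ⟨m⟩) dvd_rfl (eigenVal (i.app x y))) :=
        eigenVal_injective (by rw [eigenVal_push]; rfl)
      rw [h1] at hy
      have h2 := app_push r (x := x.unop) (y := ⟨m⟩) hx
        (eigenElt ξ m hξ (y := op ⟨m⟩) dvd_rfl (eigenVal (i.app x y)))
      rw [h0 (r.app (op ⟨m⟩) _), map_zero] at h2
      exact hy.symm.trans h2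
    · have h1 : i.app x y = 0 := eigenVal_injective (by rw [eigenVal_eq_zero hx, map_zero])
      rw [← hy, h1, map_zero]
  constructor
  · intro h
    have := ModuleCat.isZero_iff_subsingleton.1 ((Functor.isZero_iff _).1 h (op ⟨m⟩))
    have h1 := congrArg eigenVal (Subsingleton.elim (eigenElt ξ m hξ (y := op ⟨m⟩) dvd_rfl 1) 0)
    rw [eigenVal_eigenElt, map_zero] at h1
    exact one_ne_zero h1
  · intro Y Z e
    by_cases hY : ∀ y : Y.obj (op ⟨m⟩), y = 0
    · exact Or.inl (key Y (Limits.biprod.inl ≫ e.inv) (e.hom ≫ Limits.biprod.fst) (by simp) hY)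
    · refine Or.inr (key Z (Limits.biprod.inr ≫ e.inv) (e.hom ≫ Limits.biprod.snd) (by simp) ?_)
      push Not at hY
      obtain ⟨y, hy⟩ := hY
      intro z
      set i : Y ⟶ eigenModel ξ m hξ := Limits.biprod.inl ≫ e.inv
      set j : Z ⟶ eigenModel ξ m hξ := Limits.biprod.inr ≫ e.inv
      -- in the line `k`, the images of `y ≠ 0` and of `z` are dependent
      have hdep : eigenVal (j.app (op ⟨m⟩) z) • i.app (op ⟨m⟩) y =
          eigenVal (i.app (op ⟨m⟩) y) • j.app (op ⟨m⟩) z :=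
        eigenVal_injective (by rw [map_smul, map_smul, smul_eq_mul, smul_eq_mul, mul_comm])
      have hi : i ≫ (e.hom ≫ Limits.biprod.fst) = 𝟙 Y := by simp [i]
      have hj : j ≫ (e.hom ≫ Limits.biprod.fst) = 0 := by simp [j]
      have hj' : j ≫ (e.hom ≫ Limits.biprod.snd) = 𝟙 Z := by simp [j]
      generalize e.hom ≫ Limits.biprod.fst = r at hi hj
      generalize e.hom ≫ Limits.biprod.snd = s at hj'
      have h1 : r.app (op ⟨m⟩) (i.app (op ⟨m⟩) y) = y :=
        congrArg (fun α => (α.app (op ⟨m⟩)).hom y) hi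
      have h2 : r.app (op ⟨m⟩) (j.app (op ⟨m⟩) z) = 0 :=
        congrArg (fun α => (α.app (op ⟨m⟩)).hom z) hj
      have h3 : s.app (op ⟨m⟩) (j.app (op ⟨m⟩) z) = z :=
        congrArg (fun α => (α.app (op ⟨m⟩)).hom z) hj'
      have h4 := congrArg (r.app (op ⟨m⟩)) hdep
      rw [map_smul, map_smul, h1, h2, smul_zero] at h4
      have h5 : j.app (op ⟨m⟩) z = 0 :=
        eigenVal_injective (by rw [(smul_eq_zero.1 h4).resolve_right hy, map_zero])
      rw [← h3, h5, map_zero]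

end ZopModule

/-! ### Injectivity of `E(ξ, n)` -/

namespace ZopModule
open OrbitZ
variable {k : Type u} [Field k]

/-- The objects of `𝒵`, ordered by divisibility. -/
instance : Preorder OrbitZ where
  le x y := (x.idx : ℕ) ∣ y.idx
  le_refl _ := dvd_rfl
  le_trans _ _ _ := Nat.dvd_trans

instance : IsDirectedOrder OrbitZ where
  directed x y := ⟨⟨x.idx * y.idx⟩, Dvd.intro _ (PNat.mul_coe _ _).symm,
    Dvd.intro_left _ (PNat.mul_coe _ _).symm⟩

instance : Nonempty OrbitZ := ⟨⟨1⟩⟩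

noncomputable instance : DecidableEq OrbitZ := Classical.decEq _

/-- The maps `push` as the transition maps of a directed system. -/
noncomputable abbrev transition (A : ZopModule k) (x y : OrbitZ) (h : x ≤ y) :
    A.obj (op x) →ₗ[k] A.obj (op y) :=
  push A h

/-- The colimit of the values of `A` along the maps `push`, over the directed poset of positive
integers under divisibility. -/
abbrev Colim (A : ZopModule k) : Type u :=
  Module.DirectLimit (fun x : OrbitZ => A.obj (op x)) (transition A)

instance (A : ZopModule k) :
    DirectedSystem (fun x : OrbitZ => A.obj (op x)) (fun x y h => transition A x y h) where
  map_self _ v := push_self A _ v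
  map_map _ _ _ _ _ v := push_push A _ _ v

/-- The canonical map from a value of `A` to the colimit. -/
noncomputable def toColim (A : ZopModule k) (x : OrbitZ) : A.obj (op x) →ₗ[k] Colim A :=
  Module.DirectLimit.of k OrbitZ (fun x : OrbitZ => A.obj (op x)) (transition A) x

theorem toColim_push (A : ZopModule k) {x y : OrbitZ} (h : (y.idx : ℕ) ∣ x.idx)
    (a : A.obj (op y)) : toColim A x (push A h a) = toColim A y a :=
  Module.DirectLimit.of_f (f := transition A) (hij := h)

/-- The automorphism of the colimit induced by the generators of the groups `G_x`. -/
noncomputable def colimSigma (A : ZopModule k) : Module.End k (Colim A) :=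
  Module.DirectLimit.map (fun x => sigma A x)
    (fun _ _ h => LinearMap.ext fun a => (push_sigma A h a).symm)

theorem colimSigma_toColim (A : ZopModule k) (x : OrbitZ) (a : A.obj (op x)) :
    colimSigma A (toColim A x a) = toColim A x (sigma A x a) :=
  Module.DirectLimit.map_apply_of _ _ _

/-- The map of colimits induced by a morphism. -/
noncomputable def colimMap {A B : ZopModule k} (α : A ⟶ B) : Colim A →ₗ[k] Colim B :=
  Module.DirectLimit.map (fun x => (α.app (op x)).hom)
    (fun _ _ h => LinearMap.ext fun a => app_push α h a)

theorem colimMap_toColim {A B : ZopModule k} (α : A ⟶ B) (x : OrbitZ) (a : A.obj (op x)) :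
    colimMap α (toColim A x a) = toColim B x (α.app (op x) a) :=
  Module.DirectLimit.map_apply_of _ _ _

theorem exists_toColim (A : ZopModule k) (c : Colim A) : ∃ x a, toColim A x a = c :=
  Module.DirectLimit.exists_of c

/-- Filtered colimits of vector spaces are exact. -/
theorem colimMap_injective {A B : ZopModule k} (α : A ⟶ B) [Mono α] :
    Function.Injective (colimMap α) := by
  rw [injective_iff_map_eq_zero]
  intro c hc
  obtain ⟨x, a, rfl⟩ := exists_toColim A c
  rw [colimMap_toColim] at hc
  obtain ⟨y, hxy, h⟩ := Module.DirectLimit.of.zero_exact hc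
  have h1 : push A hxy a = 0 := by
    apply (mono_iff α).1 inferInstance y
    rw [app_push, map_zero]
    exact h
  rw [← toColim_push A hxy, h1, map_zero]

theorem colimSigma_pow_toColim (A : ZopModule k) (x : OrbitZ) (a : A.obj (op x)) (j : ℕ) :
    (colimSigma A ^ j) (toColim A x a) = toColim A x ((sigma A x ^ j) a) := by
  induction j with
  | zero => simp
  | succ j ih =>
    rw [pow_succ', Module.End.mul_apply, ih, colimSigma_toColim, pow_succ', Module.End.mul_apply]

/-- A morphism `A ⟶ eigenModel ξ n` amounts to a functional on the colimit of `A` on which the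
generator acts as `ξ`, and such functionals extend along injections. -/
theorem injective_eigenModel [CharZero k] {ξ : k} {n : ℕ+} (hξ : IsPrimitiveRoot ξ n) :
    Injective (eigenModel ξ n hξ.pow_eq_one) where
  factors {A B} g i _ := by
    let φ : Colim A →ₗ[k] k := Module.DirectLimit.lift k OrbitZ _ _
      (fun x => eigenVal ∘ₗ (g.app (op x)).hom)
      (fun x y h a => (congrArg eigenVal (app_push g h a)).trans (eigenVal_push _ _))
    have hφ : ∀ x a, φ (toColim A x a) = eigenVal (g.app (op x) a) :=
      fun x a => Module.DirectLimit.lift_of _ _ _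
    obtain ⟨ψ, hψ, hψi⟩ := exists_extend_eigenfunctional (colimSigma A) (colimSigma B) (colimMap i)
      (colimMap_injective i) (by
        intro c
        obtain ⟨x, a, rfl⟩ := exists_toColim A c
        rw [colimSigma_toColim, colimMap_toColim, colimMap_toColim, colimSigma_toColim, app_sigma])
      ξ (by
        intro c
        obtain ⟨x, b, rfl⟩ := exists_toColim B c
        exact ⟨x.idx, x.idx.pos, by rw [colimSigma_pow_toColim, sigma_pow_idx]; rfl⟩)
      φ (by
        intro c
        obtain ⟨x, a, rfl⟩ := exists_toColim A c
        rw [colimSigma_toColim, hφ, hφ, app_sigma, sigma_eigenModel, map_smul, smul_eq_mul])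
    refine ⟨homToEigen B (fun y => ψ ∘ₗ toColim B y) ?_ ?_ ?_, ?_⟩
    · -- `b` is fixed by the `y`-th power of the generator, while `ξ ^ y ≠ 1`
      intro y b hy
      have h1 : ∀ (j : ℕ) c, ψ ((colimSigma B ^ j) c) = ξ ^ j * ψ c := by
        intro j c
        induction j with
        | zero => simp
        | succ j ih => rw [pow_succ', Module.End.mul_apply, hψ, ih]; ring
      have h2 := h1 y.idx (toColim B y b)
      rw [colimSigma_pow_toColim, sigma_pow_idx, Module.End.one_apply] at h2
      by_contra h0
      exact hy (hξ.dvd_of_pow_eq_one _ (mul_right_cancel₀ h0 (h2.symm.trans (one_mul _).symm)))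
    · intro x y h b
      exact congrArg ψ (toColim_push B h b)
    · intro y b
      rw [LinearMap.comp_apply, LinearMap.comp_apply, ← colimSigma_toColim, hψ]
    · ext x a
      refine eigenVal_injective ?_
      have h1 : ψ (toColim B x.unop (i.app x a)) = eigenVal (g.app x a) := by
        have := hψi (toColim A x.unop a)
        rw [colimMap_toColim, hφ] at this
        exact this
      exact h1
end ZopModule

/-! ### Indecomposable injective torsion free modules -/

namespace ZopModule
open OrbitZ
variable {k : Type u} [Field k]

theorem torsionFree_of_iso {V W : ZopModule k} (e : V ≅ W) (hW : W.TorsionFree) :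
    V.TorsionFree := by
  rintro x v ⟨y, f, hf⟩
  have h1 : e.hom.app x v = 0 := hW x _ ⟨y, f, by rw [← naturality_apply, hf, map_zero]⟩
  have h2 : e.inv.app x (e.hom.app x v) = v := congrArg (fun α => (α.app x).hom v) e.hom_inv_id
  rw [← h2, h1, map_zero]

theorem indecomposable_of_iso {C : Type*} [Category C] [Limits.HasZeroMorphisms C]
    [Limits.HasBinaryBiproducts C] {X Y : C} (e : X ≅ Y) (h : Indecomposable Y) :
    Indecomposable X :=
  ⟨fun h0 => h.1 (h0.of_iso e.symm), fun A B i => h.2 A B (e.symm ≪≫ i)⟩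

/-- A nonzero injective subobject of an indecomposable object is the whole object. -/
theorem isIso_of_mono_of_indecomposable {C : Type*} [Category C] [Abelian C] {X Y : C} (f : X ⟶ Y)
    [Mono f] [Injective X] (hX : ¬ Limits.IsZero X) (hY : Indecomposable Y) : IsIso f := by
  let S := ShortComplex.mk f (Limits.cokernel.π f) (Limits.cokernel.condition f)
  have hS : S.ShortExact :=
    { exact := S.exact_of_g_is_cokernel (Limits.cokernelIsCokernel f)
      mono_f := inferInstanceAs (Mono f)
      epi_g := inferInstanceAs (Epi (Limits.cokernel.π f)) }
  have : Injective S.X₁ := inferInstanceAs (Injective X)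
  have h0 : Limits.IsZero (Limits.cokernel f) :=
    (hY.2 _ _ (hS.splittingOfInjective.isoBinaryBiproduct)).resolve_left hX
  have : Epi f := Preadditive.epi_of_cokernel_zero (h0.eq_of_tgt _ _)
  exact isIso_of_mono_of_epi f

theorem isIso_iff {V W : ZopModule k} (α : V ⟶ W) :
    IsIso α ↔ ∀ x : OrbitZ, Function.Bijective (α.app (op x)) := by
  rw [NatTrans.isIso_iff_isIso_app]
  simp only [ConcreteCategory.isIso_iff_bijective]
  exact ⟨fun h x => h (op x), fun h x => h x.unop⟩

/-- A torsion free module with an eigenvector `v` at `m` contains the submodule `eigenModel ξ m`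
generated by `v`; if it is injective, then it also contains the module `eigenModel ξ n`, in which
`eigenModel ξ m` sits by divisibility. -/
theorem exists_mono_of_eigenvector {V : ZopModule k} [Injective V] (hV : V.TorsionFree) {ξ : k}
    {n m : ℕ+} (hn : ξ ^ (n : ℕ) = 1) (hnm : (n : ℕ) ∣ m) (v : V.obj (op ⟨m⟩))
    (hv : sigma V ⟨m⟩ v = ξ • v) (h0 : v ≠ 0) : ∃ β : eigenModel ξ n hn ⟶ V, Mono β := by
  have hm : ξ ^ (m : ℕ) = 1 := pow_idx_eq_one V hv h0
  let w : (eigenModel ξ n hn).obj (op ⟨m⟩) := eigenElt ξ n hn (y := op ⟨m⟩) hnm 1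
  let ι : eigenModel ξ m hm ⟶ eigenModel ξ n hn := homOfEigenvector w (sigma_eigenModel w)
  let α : eigenModel ξ m hm ⟶ V := homOfEigenvector v hv
  have : Mono ι := by
    rw [mono_iff]
    intro x c d hcd
    by_cases hx : (m : ℕ) ∣ x.idx
    · have h1 := congrArg eigenVal hcd
      simp only [ι, homOfEigenvector_app _ _ hx, map_smul, eigenVal_push] at h1
      exact eigenVal_injective (by simpa [w, eigenVal_eigenElt] using h1)
    · exact eigenVal_injective (by
        rw [eigenVal_eq_zero (y := op x) hx, eigenVal_eq_zero (y := op x) hx])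
  refine ⟨Injective.factorThru α ι, ?_⟩
  have hβ := Injective.comp_factorThru α ι
  generalize Injective.factorThru α ι = β at hβ
  have hw : β.app (op ⟨m⟩) w = v := by
    let c : (eigenModel ξ m hm).obj (op ⟨m⟩) := eigenElt ξ m hm (y := op ⟨m⟩) dvd_rfl 1
    have h1 : β.app (op ⟨m⟩) (ι.app (op ⟨m⟩) c) = α.app (op ⟨m⟩) c :=
      congrArg (fun γ => (γ.app (op ⟨m⟩)).hom c) hβ
    simpa only [ι, α, c, homOfEigenvector_app _ _ (y := ⟨m⟩) dvd_rfl, eigenVal_eigenElt, one_smul,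
      push_self] using h1
  rw [mono_iff]
  intro x
  rw [injective_iff_map_eq_zero]
  intro c hc
  -- at the common multiple `m * x` the image of `c` is a multiple of the image of `w`
  let z : OrbitZ := ⟨m * x.idx⟩
  have hxz : (x.idx : ℕ) ∣ z.idx := Dvd.intro_left _ (PNat.mul_coe _ _).symm
  have hmz : (m : ℕ) ∣ z.idx := Dvd.intro _ (PNat.mul_coe _ _).symm
  have h1 : push (eigenModel ξ n hn) hxz c =
      eigenVal c • push (eigenModel ξ n hn) (x := z) (y := ⟨m⟩) hmz w :=
    eigenVal_injective (by
      rw [map_smul, eigenVal_push, eigenVal_push]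
      simp [w, eigenVal_eigenElt])
  have h2 : β.app (op z) (push (eigenModel ξ n hn) hxz c) = 0 := by
    rw [app_push, hc, map_zero]
  rw [h1, map_smul, app_push, hw, smul_eq_zero] at h2
  refine eigenVal_injective ?_
  rw [map_zero]
  exact h2.resolve_right fun h3 => h0 (hV _ v ⟨_, _, h3⟩)

/-- Every indecomposable injective torsion free module is the model of some `L_ξ`. -/
theorem exists_iso_eigenModel [IsAlgClosed k] [CharZero k] {V : ZopModule k} (hV : Indecomposable V)
    [Injective V] (hV' : V.TorsionFree) :
    ∃ (ξ : k) (n : ℕ+) (h : IsPrimitiveRoot ξ n), Nonempty (eigenModel ξ n h.pow_eq_one ≅ V) := by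
  obtain ⟨x, v, hv⟩ : ∃ (x : OrbitZ) (v : V.obj (op x)), v ≠ 0 := by
    by_contra! h
    refine hV.1 ((Functor.isZero_iff _).2 fun x => ?_)
    exact ModuleCat.isZero_iff_subsingleton.2 (subsingleton_of_forall_eq 0 (h x.unop))
  obtain ⟨ξ, w, hw0, hw⟩ :=
    exists_eigenvector_of_pow_eq_one (sigma V x) x.idx.pos (sigma_pow_idx V x) v hv
  have h1 := pow_idx_eq_one V hw hw0
  have hdvd := orderOf_dvd_of_pow_eq_one h1
  let n : ℕ+ := ⟨orderOf ξ, Nat.pos_of_dvd_of_pos hdvd x.idx.pos⟩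
  have hn : IsPrimitiveRoot ξ n := IsPrimitiveRoot.orderOf ξ
  obtain ⟨β, hβ⟩ := exists_mono_of_eigenvector hV' hn.pow_eq_one (m := x.idx) hdvd w hw hw0
  have := injective_eigenModel hn
  have := isIso_of_mono_of_indecomposable β (indecomposable_eigenModel hn.pow_eq_one).1 hV
  exact ⟨ξ, n, hn, ⟨asIso β⟩⟩

end ZopModule

/-! ### The module generated by `L_ξ` -/

namespace ZopModule
open OrbitZ
variable {k : Type u} [Field k]

theorem mem_generated_self (V : ZopModule k) (x : OrbitZᵒᵖ) (W : Submodule k (V.obj x))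
    {v : V.obj x} (hv : v ∈ W) : v ∈ ⨆ f : x ⟶ x, W.map (V.map f).hom :=
  Submodule.mem_iSup_of_mem (𝟙 x) ⟨v, hv, by simp⟩

/-- The submodule generated by the line spanned by a non-torsion eigenvector is a model. -/
theorem nonempty_eigenModel_iso_generated (V : ZopModule k) {ξ : k} {m : ℕ+}
    (hξ : ξ ^ (m : ℕ) = 1) (W : Submodule k (V.obj (op ⟨m⟩))) (v : V.obj (op ⟨m⟩))
    (hW : W = Submodule.span k {v}) (hv : sigma V ⟨m⟩ v = ξ • v)
    (h0 : ∀ (x : OrbitZ) (h : (m : ℕ) ∣ x.idx), push V (x := x) (y := ⟨m⟩) h v ≠ 0) :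
    Nonempty (eigenModel ξ m hξ ≅ V.generated (op ⟨m⟩) W) := by
  have hvW : v ∈ W := hW ▸ Submodule.mem_span_singleton_self v
  let v' : (V.generated (op ⟨m⟩) W).obj (op ⟨m⟩) := ⟨v, mem_generated_self V _ W hvW⟩
  have hv' : sigma (V.generated (op ⟨m⟩) W) ⟨m⟩ v' = ξ • v' := Subtype.ext hv
  let α : eigenModel ξ m hξ ⟶ V.generated (op ⟨m⟩) W := homOfEigenvector v' hv'
  suffices IsIso α from ⟨asIso α⟩
  rw [isIso_iff]
  intro x
  by_cases hx : (m : ℕ) ∣ x.idx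
  · have hα : ∀ c, (α.app (op x) c).1 = eigenVal c • push V (x := x) (y := ⟨m⟩) hx v := fun c =>
      congrArg Subtype.val (homOfEigenvector_app v' hv' hx c)
    constructor
    · intro c d hcd
      have h1 := congrArg Subtype.val hcd
      rw [hα, hα, ← sub_eq_zero, ← sub_smul] at h1
      exact eigenVal_injective (sub_eq_zero.1 ((smul_eq_zero.1 h1).resolve_right (h0 x hx)))
    · rintro ⟨u, hu⟩
      have hle : (⨆ f : (op ⟨m⟩ : OrbitZᵒᵖ) ⟶ op x, W.map (V.map f).hom) ≤
          Submodule.span k {push V (x := x) (y := ⟨m⟩) hx v} := by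
        refine iSup_le fun f => ?_
        rintro _ ⟨w, hw, rfl⟩
        rw [hW] at hw
        obtain ⟨c, rfl⟩ := Submodule.mem_span_singleton.1 hw
        have h1 := map_eq V f.unop v
        rw [sigma_pow_of_eigen V hv, map_smul, Quiver.Hom.op_unop] at h1
        rw [map_smul]
        refine Submodule.smul_mem _ _ ?_
        exact Submodule.mem_span_singleton.2 ⟨_, h1.symm⟩
      obtain ⟨c, hc⟩ := Submodule.mem_span_singleton.1 (hle hu)
      exact ⟨eigenElt ξ m hξ (y := op x) hx c, Subtype.ext ((hα _).trans hc)⟩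
  · constructor
    · intro c d _
      exact eigenVal_injective (by
        rw [eigenVal_eq_zero (y := op x) hx, eigenVal_eq_zero (y := op x) hx])
    · rintro ⟨u, hu⟩
      have : IsEmpty ((op ⟨m⟩ : OrbitZᵒᵖ) ⟶ op x) := ⟨fun f => hx (dvd_of_hom f.unop)⟩
      rw [iSup_of_empty, Submodule.mem_bot] at hu
      exact ⟨0, Subtype.ext (by rw [map_zero]; exact hu.symm)⟩

end ZopModule

section
open OrbitZ ZopModule
variable {k : Type u} [Field k]

theorem push_linearization_injective {n x y : OrbitZ} (h : (y.idx : ℕ) ∣ x.idx) :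
    Function.Injective (push (linearization k n) h) := by
  refine Finsupp.mapDomain_injective fun f g hfg => ?_
  apply Hom.ext
  funext t
  obtain ⟨s, rfl⟩ := proj_surjective h t
  exact congrFun (congrArg Hom.toFun hfg) s

theorem sigma_linearization_single {n x : OrbitZ} (f : x ⟶ n) (c : k) :
    sigma (linearization k n) x (Finsupp.single f c : (x ⟶ n) →₀ k) =
      (Finsupp.single (shift x ≫ f) c : (x ⟶ n) →₀ k) :=
  Finsupp.mapDomain_single

theorem shift_comp_injective {n x : OrbitZ} :
    Function.Injective (fun f : x ⟶ n => shift x ≫ f) := by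
  intro f g hfg
  apply Hom.ext
  funext t
  have h := congrFun (congrArg Hom.toFun hfg) (t - 1)
  have h1 : (shift x).toFun (t - 1) = t := add_sub_cancel _ _
  simp only [toFun_comp, h1] at h
  exact h

/-- The coefficient at `f` of an element of `k𝒵(x, n)`. -/
noncomputable def coeffAt {n x : OrbitZ} (f : x ⟶ n) : (linearization k n).obj (op x) →ₗ[k] k :=
  Finsupp.lapply (M := k) f

theorem coeffAt_ext {n x : OrbitZ} {u v : (linearization k n).obj (op x)}
    (h : ∀ f, coeffAt f u = coeffAt f v) : u = v :=
  Finsupp.ext (M := k) h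

theorem coeffAt_sigma {n x : OrbitZ} (u : (linearization k n).obj (op x)) (f : x ⟶ n) :
    coeffAt (shift x ≫ f) (sigma (linearization k n) x u) = coeffAt f u :=
  Finsupp.mapDomain_apply (M := k) shift_comp_injective u f

/-- The eigenvector `∑ j < n, ξ⁻ʲ gʲ` of the group algebra `kG_n`, where `g` is the generator. -/
noncomputable def regularEigenvector (ξ : k) (x : OrbitZ) :
    (linearization k x).obj (op x) :=
  (∑ j ∈ Finset.range x.idx, Finsupp.single (translateBy x j) (ξ⁻¹ ^ j) : (x ⟶ x) →₀ k)

theorem sigma_regularEigenvector {ξ : k} {x : OrbitZ} (hξ : ξ ^ (x.idx : ℕ) = 1) :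
    sigma (linearization k x) x (regularEigenvector ξ x) = ξ • regularEigenvector ξ x := by
  have hξ0 : ξ ≠ 0 := by
    rintro rfl
    simp at hξ
  have h1 : sigma (linearization k x) x (regularEigenvector ξ x) =
      (∑ j ∈ Finset.range x.idx, Finsupp.single (translateBy x (j + 1)) (ξ⁻¹ ^ j) :
        (x ⟶ x) →₀ k) := by
    refine (map_sum (sigma (linearization k x) x)
      (fun j => (Finsupp.single (translateBy x j) (ξ⁻¹ ^ j) : (x ⟶ x) →₀ k)) _).trans ?_
    refine Finset.sum_congr rfl fun j _ => ?_
    rw [← shift_translateBy]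
    exact sigma_linearization_single _ _
  have h2 : ∀ j, (Finsupp.single (translateBy x (j + 1)) (ξ⁻¹ ^ j) : (x ⟶ x) →₀ k) =
      ξ • Finsupp.single (translateBy x (j + 1)) (ξ⁻¹ ^ (j + 1)) := by
    intro j
    rw [Finsupp.smul_single, smul_eq_mul, pow_succ', mul_inv_cancel_left₀ hξ0]
  rw [Finset.sum_congr rfl fun j _ => h2 j, ← Finset.smul_sum] at h1
  refine h1.trans (congrArg (ξ • ·) ?_)
  -- the sum over `1, …, n` is the sum over `0, …, n - 1`, as the terms at `0` and `n` agree
  have h3 := Finset.sum_range_succ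
    (fun j => (Finsupp.single (translateBy x j) (ξ⁻¹ ^ j) : (x ⟶ x) →₀ k)) x.idx
  rw [Finset.sum_range_succ', translateBy_idx, translateBy_zero, inv_pow ξ x.idx, hξ,
    inv_one, pow_zero] at h3
  exact add_right_cancel h3

theorem coeffAt_id_regularEigenvector (ξ : k) (x : OrbitZ) :
    coeffAt (𝟙 x) (regularEigenvector ξ x) = 1 := by
  classical
  change (∑ j ∈ Finset.range x.idx, Finsupp.single (translateBy x j) (ξ⁻¹ ^ j) : (x ⟶ x) →₀ k)
    (𝟙 x) = 1
  rw [Finsupp.finsetSum_apply,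
    Finset.sum_eq_single_of_mem 0 (Finset.mem_range.2 x.idx.pos)]
  · rw [translateBy_zero, pow_zero, Finsupp.single_eq_same]
  · intro j hj hj0
    refine Finsupp.single_eq_of_ne fun h => hj0 ?_
    have h1 := congrFun (congrArg Hom.toFun h) 0
    have h2 : ((j : ℕ) : ZMod x.idx) = 0 := by
      rw [toFun_id] at h1
      simpa [translateBy] using h1.symm
    exact Nat.eq_zero_of_dvd_of_lt ((ZMod.natCast_eq_zero_iff _ _).1 h2) (Finset.mem_range.1 hj)

/-- `L_ξ` is one-dimensional: an eigenvector of the generator in `kG_n` is determined by its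
coefficient at the identity. -/
theorem charSubmodule_eq_span {ξ : k} {n : ℕ+} (hξ : ξ ^ (n : ℕ) = 1) :
    charSubmodule n ξ = Submodule.span k {regularEigenvector ξ ⟨n⟩} := by
  have hξ0 : ξ ≠ 0 := by
    rintro rfl
    simp at hξ
  apply le_antisymm
  · intro u hu
    have hu' := Module.End.mem_eigenspace_iff.1 hu
    have hv' := sigma_regularEigenvector (x := ⟨n⟩) hξ
    have key : ∀ w : (linearization k ⟨n⟩).obj (op ⟨n⟩),
        sigma (linearization k ⟨n⟩) ⟨n⟩ w = ξ • w →
        ∀ j, ξ ^ j * coeffAt (translateBy ⟨n⟩ j) w = coeffAt (𝟙 _) w := by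
      intro w hw j
      induction j with
      | zero => rw [translateBy_zero, pow_zero, one_mul]
      | succ j ih =>
        have h1 := coeffAt_sigma w (translateBy ⟨n⟩ j)
        rw [hw, shift_translateBy, map_smul, smul_eq_mul] at h1
        rw [← ih, ← h1, pow_succ, mul_assoc]
    refine Submodule.mem_span_singleton.2 ⟨coeffAt (𝟙 _) u, coeffAt_ext fun f => ?_⟩
    rw [eq_translateBy_offset f]
    apply mul_left_cancel₀ (pow_ne_zero (offset f) hξ0)
    rw [key u hu', map_smul, smul_eq_mul, mul_left_comm, key _ hv', coeffAt_id_regularEigenvector,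
      mul_one]
  · refine (Submodule.span_singleton_le_iff_mem _ _).2 ?_
    exact Module.End.mem_eigenspace_iff.2 (sigma_regularEigenvector (x := ⟨n⟩) hξ)

theorem PrimRoot.isPrimitiveRoot_order (ξ : PrimRoot k) : IsPrimitiveRoot ξ.1 (ξ.order : ℕ) :=
  IsPrimitiveRoot.orderOf ξ.1

theorem nonempty_eigenModel_iso_rootModule (ξ : PrimRoot k) :
    Nonempty (eigenModel ξ.1 ξ.order ξ.isPrimitiveRoot_order.pow_eq_one ≅ rootModule ξ) := by
  have h1 := ξ.isPrimitiveRoot_order.pow_eq_one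
  refine nonempty_eigenModel_iso_generated _ h1 _ (regularEigenvector ξ.1 ⟨ξ.order⟩)
    (charSubmodule_eq_span h1) (sigma_regularEigenvector h1) fun x h h0 => ?_
  have h2 : regularEigenvector ξ.1 ⟨ξ.order⟩ = 0 :=
    push_linearization_injective (y := ⟨ξ.order⟩) h (h0.trans (map_zero _).symm)
  have h3 := coeffAt_id_regularEigenvector ξ.1 ⟨ξ.order⟩
  rw [h2, map_zero] at h3
  exact zero_ne_one h3

end

/-! ### The classification -/

theorem mainTheorem5 (k : Type u) [Field k] [IsAlgClosed k] [CharZero k] :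
    Set.BijOn
      (fun ξ : PrimRoot k => Quotient.mk (isIsomorphicSetoid (ZopModule k)) (rootModule ξ))
      Set.univ (indecInjTorsionFreeClasses k) ∧
    ∀ (ξ : PrimRoot k) (n : ℕ+), IsPrimitiveRoot ξ.1 (n : ℕ) → ∀ m : ℕ+,
      (∀ h : (n : ℕ) ∣ (m : ℕ),
        Module.finrank k ((rootModule ξ).obj (op ⟨m⟩)) = 1 ∧
        (∀ v : (rootModule ξ).obj (op ⟨m⟩),
          (rootModule ξ).map (OrbitZ.shift ⟨m⟩).op v = ξ.1 • v) ∧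
        Function.Bijective
          ((rootModule ξ).map (OrbitZ.proj (x := ⟨m⟩) (y := ⟨n⟩) h).op)) ∧
      (¬ (n : ℕ) ∣ (m : ℕ) → Subsingleton ((rootModule ξ).obj (op ⟨m⟩))) := by
  refine ⟨⟨fun ξ _ => ?_, fun ξ _ η _ h => ?_, ?_⟩, fun ξ n hn m => ?_⟩
  · obtain ⟨e⟩ := nonempty_eigenModel_iso_rootModule ξ
    have hξ := ξ.isPrimitiveRoot_order
    exact ⟨rootModule ξ,
      ZopModule.indecomposable_of_iso e.symm (ZopModule.indecomposable_eigenModel hξ.pow_eq_one),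
      Injective.of_iso e (ZopModule.injective_eigenModel hξ),
      ZopModule.torsionFree_of_iso e.symm (ZopModule.torsionFree_eigenModel hξ.pow_eq_one), rfl⟩
  · obtain ⟨i⟩ := Quotient.exact h
    obtain ⟨e⟩ := nonempty_eigenModel_iso_rootModule ξ
    obtain ⟨e'⟩ := nonempty_eigenModel_iso_rootModule η
    exact Subtype.ext (ZopModule.eq_of_eigenModel_iso (e ≪≫ i ≪≫ e'.symm))
  · rintro _ ⟨V, hV, hinj, htf, rfl⟩
    obtain ⟨ξ, n, hn, ⟨e⟩⟩ := ZopModule.exists_iso_eigenModel hV htf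
    let ζ : PrimRoot k := ⟨ξ, n, hn⟩
    have hζ : n = ζ.order := PNat.coe_injective hn.eq_orderOf
    obtain ⟨e'⟩ := nonempty_eigenModel_iso_rootModule ζ
    simp only [← hζ] at e'
    exact ⟨ζ, Set.mem_univ _, Quotient.sound ⟨e'.symm ≪≫ e⟩⟩
  · obtain rfl : n = ξ.order := PNat.coe_injective hn.eq_orderOf
    obtain ⟨e⟩ := nonempty_eigenModel_iso_rootModule ξ
    have hbij := (ZopModule.isIso_iff e.hom).1 inferInstance
    refine ⟨fun h => ⟨?_, fun v => ?_, ?_⟩, fun h => ?_⟩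
    · rw [← ZopModule.finrank_eigenModel hn.pow_eq_one (x := ⟨m⟩) h]
      exact (LinearEquiv.ofBijective (e.hom.app (op ⟨m⟩)).hom (hbij ⟨m⟩)).finrank_eq.symm
    · obtain ⟨c, rfl⟩ := (hbij ⟨m⟩).2 v
      refine (ZopModule.app_sigma e.hom ⟨m⟩ c).symm.trans ?_
      rw [ZopModule.sigma_eigenModel, map_smul]
    · have hpush : Function.Bijective (ZopModule.push
          (ZopModule.eigenModel ξ.1 ξ.order hn.pow_eq_one) (x := ⟨m⟩) (y := ⟨ξ.order⟩) h) := by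
        constructor
        · intro c d hcd
          have := congrArg ZopModule.eigenVal hcd
          rw [ZopModule.eigenVal_push, ZopModule.eigenVal_push] at this
          exact ZopModule.eigenVal_injective this
        · intro c
          exact ⟨ZopModule.eigenElt ξ.1 ξ.order _ (y := op ⟨ξ.order⟩) dvd_rfl (ZopModule.eigenVal c),
            ZopModule.eigenVal_injective (ZopModule.eigenVal_push _ _)⟩
      have hcomp : (ZopModule.push (rootModule ξ) (x := ⟨m⟩) (y := ⟨ξ.order⟩) h) ∘
          (e.hom.app (op ⟨ξ.order⟩)) = (e.hom.app (op ⟨m⟩)) ∘ (ZopModule.push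
          (ZopModule.eigenModel ξ.1 ξ.order hn.pow_eq_one) (x := ⟨m⟩) (y := ⟨ξ.order⟩) h) :=
        funext fun c => (ZopModule.app_push e.hom _ c).symm
      exact (Function.Bijective.of_comp_iff _ (hbij ⟨ξ.order⟩)).1
        (hcomp ▸ (hbij ⟨m⟩).comp hpush)
    · have : Subsingleton
          ((ZopModule.eigenModel ξ.1 ξ.order hn.pow_eq_one).obj (op ⟨m⟩)) :=
        ⟨fun c d => ZopModule.eigenVal_injective (by
          rw [ZopModule.eigenVal_eq_zero (y := op ⟨m⟩) h,
            ZopModule.eigenVal_eq_zero (y := op ⟨m⟩) h])⟩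
      exact (hbij ⟨m⟩).2.subsingleton
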